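/- Let $k$ be a field, let $G$ be a finite abelian group that splits over $k$ (that is, the group algebra $kG$ is isomorphic as a $k$-algebra to a finite product of copies of $k$), and let $\mathcal{C}$ be a skeletally small $k$-linear additive category that is idempotent complete. Let a $k$-linear $G$-action on $\mathcal{C}$ be given, that is, $k$-linear autoequivalences $F_g\colon\mathcal{C}\to\mathcal{C}$ $(g\in G)$ and natural isomorphisms $\varepsilon_{g,h}\colon F_gF_h\to F_{gh}$ with $\varepsilon_{gh,l}\circ\varepsilon_{g,h}F_l=\varepsilon_{g,hl}\circ F_g\varepsilon_{h,l}$ for all $g,h,l\in G$. Let $\mathcal{C}^G$ be the category of $G$-equivariant objects: pairs $(X,\alpha)$ of an object $X$ of $\mathcal{C}$ and isomorphisms $\alpha_g\colon X\to F_g(X)$ $(g\in G)$ with $\alpha_{gh}=(\varepsilon_{g,h})_X\circ F_g(\alpha_h)\circ\alpha_g$; a morphism $(X,\alpha)\to(Y,\beta)$ is a morphism $f\colon X\to Y$ with $\beta_g\circ f=F_g(f)\circ\alpha_g$ for all $g$. The character group $\widehat{G}=\mathrm{Hom}(G,k^*)$ acts strictly and $k$-linearly on $\mathcal{C}^G$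 by $F_\chi(X,\alpha)=(X,(\chi(g^{-1})\alpha_g)_{g\in G})$, $F_\chi(f)=f$ (the dual action). For a $k$-linear category $\mathcal{D}$ with a $k$-linear action $\{F_h,\varepsilon_{h,h'}\}$ of a group $H$, let $\mathrm{Aut}(\mathcal{D};H)$ be the group of isomorphism classes $[F,\delta]$ of $k$-linear $H$-equivariant autoequivalences: $F\colon\mathcal{D}\to\mathcal{D}$ is a $k$-linear autoequivalence and $\delta_h\colon FF_h\to F_hF$ are natural isomorphisms with $\delta_{hh'}\circ F\varepsilon_{h,h'}=\varepsilon_{h,h'}F\circ F_h\delta_{h'}\circ\delta_hF_{h'}$. An isomorphism $(F,\delta)\to(F',\delta')$ is a natural isomorphism $\phi\colon F\to F'$ with $F_h\phi\circ\delta_h=\delta'_h\circ\phi F_h$ for all $h$, and the product is $[F,\delta][F',\delta']=[FF',(\delta_hF'\circ F\delta'_h)_h]$. Let $\mathrm{Act}(\mathcal{D};H)\subseteq\mathrm{Aut}(\mathcal{D};H)$ be the subgroup of those $[F,\delta]$ such that $F$ is isomorphic, as a functor, to $F_a$ for some $a\in H$. The equivariantization homomorphism $(-)^G\colon\mathrm{Aut}(\mathcal{C};G)\to\mathrm{Aut}(\mathcal{C}^G;\widehat{G})$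 sends $[F,\delta]$ to the class of the functor $(X,\alpha)\mapsto(F(X),((\delta_g)_X\circ F(\alpha_g))_{g\in G})$, $f\mapsto F(f)$, which commutes strictly with every $F_\chi$ and is given the identities as its $\widehat{G}$-equivariant structure. For a $k$-linear category $\mathcal{D}$ let $Z(\mathcal{D})$ be the $k$-algebra of natural endomorphisms of $\mathrm{Id}_{\mathcal{D}}$; write $Z(\mathcal{D})=k$ if the structure map $k\to Z(\mathcal{D})$ is bijective. Assume that $Z(\mathcal{C})=k=Z(\mathcal{C}^G)$. Then $(-)^G$ restricts to an isomorphism of groups $$(-)^G\colon\mathrm{Act}(\mathcal{C};G)\longrightarrow\mathrm{Act}(\mathcal{C}^G;\widehat{G}).$$ -/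

import Mathlib

open CategoryTheory CategoryTheory.Limits

namespace Equivariantization

universe w x v u

lemma id_comm {C : Type u} [Category.{v} C] {F : C ⥤ C} {X : C} {a b : X ⟶ F.obj X}
    (h : a = b) : 𝟙 X ≫ a = b ≫ F.map (𝟙 X) := by
  simp [h]

/-- A `k`-linear action of a group `G` on a `k`-linear category `C`: `k`-linear autoequivalences
`F g` and natural isomorphisms `ε g h : F_g F_h ≅ F_{gh}` satisfying the 2-cocycle condition
`ε_{gh,l} ∘ ε_{g,h} F_l = ε_{g,hl} ∘ F_g ε_{h,l}`.  In Lean `F h ⋙ F g` is the composite `F_g F_h`;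
the `eqToHom` only identifies `F_{(gh)l}` with `F_{g(hl)}`. -/
structure LinearAction (k : Type w) [Field k] (G : Type x) [Group G]
    (C : Type u) [Category.{v} C] [Preadditive C] [Linear k C] where
  F : G → C ⥤ C
  isEquivalence : ∀ g, (F g).IsEquivalence
  additive : ∀ g, (F g).Additive
  linear : ∀ g, (F g).Linear k
  ε : ∀ g h : G, F h ⋙ F g ≅ F (g * h)
  cocycle : ∀ (g h l : G) (X : C),
    (ε g h).hom.app ((F l).obj X) ≫ (ε (g * h) l).hom.app X ≫
        eqToHom (congrArg (fun a => (F a).obj X) (mul_assoc g h l)) =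
      (F g).map ((ε h l).hom.app X) ≫ (ε g (h * l)).hom.app X

section

variable {k : Type w} [Field k] {G : Type x} [Group G]
  {C : Type u} [Category.{v} C] [Preadditive C] [Linear k C]

attribute [instance] LinearAction.isEquivalence LinearAction.additive LinearAction.linear

/-! ### The category of equivariant objects -/

/-- A `G`-equivariant object `(X, α)`: isomorphisms `α_g : X ≅ F_g X` with
`α_{gh} = (ε_{g,h})_X ∘ F_g(α_h) ∘ α_g`. -/
structure EquivariantObject (A : LinearAction k G C) where
  X : C
  α : ∀ g : G, X ≅ (A.F g).obj X
  rel : ∀ g h : G,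
    (α (g * h)).hom = (α g).hom ≫ (A.F g).map (α h).hom ≫ (A.ε g h).hom.app X

namespace EquivariantObject

variable {A : LinearAction k G C}

/-- A morphism `(X, α) ⟶ (Y, β)` is an `f : X ⟶ Y` with `β_g ∘ f = F_g(f) ∘ α_g`. -/
@[ext]
structure Hom (P Q : EquivariantObject A) where
  f : P.X ⟶ Q.X
  comm : ∀ g : G, f ≫ (Q.α g).hom = (P.α g).hom ≫ (A.F g).map f

lemma Hom.comm_assoc {P Q : EquivariantObject A} (a : Hom P Q) (g : G) {Z : C}
    (h : (A.F g).obj Q.X ⟶ Z) :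
    a.f ≫ (Q.α g).hom ≫ h = (P.α g).hom ≫ (A.F g).map a.f ≫ h := by
  rw [← Category.assoc, a.comm, Category.assoc]

instance : Category (EquivariantObject A) where
  Hom P Q := Hom P Q
  id P := { f := 𝟙 P.X, comm := fun g => by simp }
  comp a b := { f := a.f ≫ b.f, comm := fun g => by simp [Hom.comm, Hom.comm_assoc] }

@[simp] lemma id_f (P : EquivariantObject A) : Hom.f (𝟙 P) = 𝟙 P.X := rfl

@[simp] lemma comp_f {P Q R : EquivariantObject A} (a : P ⟶ Q) (b : Q ⟶ R) :
    (a ≫ b).f = a.f ≫ b.f := rfl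

@[ext]
lemma hom_ext {P Q : EquivariantObject A} {a b : P ⟶ Q} (h : a.f = b.f) : a = b :=
  Hom.ext h

lemma eqToHom_f {P Q : EquivariantObject A} (h : P = Q) :
    (eqToHom h).f = eqToHom (congrArg EquivariantObject.X h) := by
  subst h
  rfl

/-- An isomorphism of equivariant objects from an isomorphism of the underlying objects. -/
@[simps]
def isoMk {P Q : EquivariantObject A} (e : P.X ≅ Q.X)
    (comm : ∀ g : G, e.hom ≫ (Q.α g).hom = (P.α g).hom ≫ (A.F g).map e.hom) : P ≅ Q where
  hom := { f := e.hom, comm := comm }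
  inv :=
    { f := e.inv
      comm := fun g => by
        rw [Iso.inv_comp_eq, ← Category.assoc, comm g, Category.assoc, ← Functor.map_comp]
        simp }
  hom_inv_id := by ext; simp
  inv_hom_id := by ext; simp

variable (P Q : EquivariantObject A)

instance : Add (P ⟶ Q) where
  add a b := { f := a.f + b.f, comm := fun g => by simp [Hom.comm, Functor.map_add] }

instance : Zero (P ⟶ Q) where
  zero := { f := 0, comm := fun g => by simp }

instance : Neg (P ⟶ Q) where
  neg a := { f := -a.f, comm := fun g => by simp [Hom.comm, Functor.map_neg] }

instance : Sub (P ⟶ Q) where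
  sub a b := { f := a.f - b.f, comm := fun g => by simp [Hom.comm, Functor.map_sub] }

instance : SMul k (P ⟶ Q) where
  smul c a := { f := c • a.f, comm := fun g => by simp [Hom.comm, Functor.map_smul] }

instance : SMul ℕ (P ⟶ Q) where
  smul n a := { f := n • a.f, comm := fun g => by simp [Hom.comm] }

instance : SMul ℤ (P ⟶ Q) where
  smul n a := { f := n • a.f, comm := fun g => by simp [Hom.comm] }

variable {P Q}

@[simp] lemma add_f (a b : P ⟶ Q) : (a + b).f = a.f + b.f := rfl
@[simp] lemma zero_f : (0 : P ⟶ Q).f = 0 := rfl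
@[simp] lemma neg_f (a : P ⟶ Q) : (-a).f = -a.f := rfl
@[simp] lemma sub_f (a b : P ⟶ Q) : (a - b).f = a.f - b.f := rfl
@[simp] lemma smul_f (c : k) (a : P ⟶ Q) : (c • a).f = c • a.f := rfl

lemma f_injective : Function.Injective (fun a : P ⟶ Q => a.f) := fun _ _ h => hom_ext h

instance : AddCommGroup (P ⟶ Q) :=
  f_injective.addCommGroup _ rfl (fun _ _ => rfl) (fun _ => rfl) (fun _ _ => rfl)
    (fun _ _ => rfl) (fun _ _ => rfl)

instance : Preadditive (EquivariantObject A) where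
  add_comp _ _ _ a b c := by ext; simp
  comp_add _ _ _ a b c := by ext; simp

/-- The underlying morphism, as an additive map. -/
def fAddHom : (P ⟶ Q) →+ (P.X ⟶ Q.X) where
  toFun a := a.f
  map_zero' := rfl
  map_add' _ _ := rfl

instance : Module k (P ⟶ Q) :=
  Function.Injective.module k fAddHom f_injective (fun _ _ => rfl)

instance : Linear k (EquivariantObject A) where
  smul_comp _ _ _ c a b := by ext; simp
  comp_smul _ _ _ a c b := by ext; simp

end EquivariantObject

/-! ### The group of equivariant autoequivalences -/

/-- A `k`-linear `G`-equivariant autoequivalence `(F, δ)`, with `δ_g : F F_g ≅ F_g F` satisfying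
`δ_{gh} ∘ F ε_{g,h} = ε_{g,h} F ∘ (F_g δ_h ∘ δ_g F_h)`. -/
structure EquivariantAutoequivalence (A : LinearAction k G C) where
  F : C ⥤ C
  isEquivalence : F.IsEquivalence
  additive : F.Additive
  linear : F.Linear k
  δ : ∀ g : G, A.F g ⋙ F ≅ F ⋙ A.F g
  compat : ∀ (g h : G) (X : C),
    F.map ((A.ε g h).hom.app X) ≫ (δ (g * h)).hom.app X =
      (δ g).hom.app ((A.F h).obj X) ≫ (A.F g).map ((δ h).hom.app X) ≫
        (A.ε g h).hom.app (F.obj X)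

attribute [instance] EquivariantAutoequivalence.isEquivalence
  EquivariantAutoequivalence.additive EquivariantAutoequivalence.linear

namespace EquivariantAutoequivalence

variable {A : LinearAction k G C}

/-- Isomorphism of equivariant autoequivalences: a natural isomorphism `φ : F ≅ F'` with
`F_g φ ∘ δ_g = δ'_g ∘ φ F_g`. -/
def Isomorphic (E E' : EquivariantAutoequivalence A) : Prop :=
  ∃ φ : E.F ≅ E'.F, ∀ (g : G) (X : C),
    (E.δ g).hom.app X ≫ (A.F g).map (φ.hom.app X) =
      φ.hom.app ((A.F g).obj X) ≫ (E'.δ g).hom.app X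

lemma isomorphic_refl (E : EquivariantAutoequivalence A) : E.Isomorphic E :=
  ⟨Iso.refl _, fun g X => by simp⟩

lemma Isomorphic.symm {E E' : EquivariantAutoequivalence A} (h : E.Isomorphic E') :
    E'.Isomorphic E := by
  obtain ⟨φ, hφ⟩ := h
  refine ⟨φ.symm, fun g X => ?_⟩
  rw [← cancel_epi (φ.hom.app ((A.F g).obj X)), ← Category.assoc, ← hφ, Category.assoc,
    ← Functor.map_comp]
  simp

lemma Isomorphic.trans {E E' E'' : EquivariantAutoequivalence A} (h : E.Isomorphic E')
    (h' : E'.Isomorphic E'') : E.Isomorphic E'' := by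
  obtain ⟨φ, hφ⟩ := h
  obtain ⟨ψ, hψ⟩ := h'
  refine ⟨φ ≪≫ ψ, fun g X => ?_⟩
  simp only [Iso.trans_hom, NatTrans.comp_app, Functor.map_comp, Category.assoc]
  rw [← Category.assoc, hφ, Category.assoc, hψ]

instance setoid (A : LinearAction k G C) : Setoid (EquivariantAutoequivalence A) where
  r := Isomorphic
  iseqv := ⟨isomorphic_refl, Isomorphic.symm, Isomorphic.trans⟩

/-- The identity equivariant functor. -/
def one (A : LinearAction k G C) : EquivariantAutoequivalence A where
  F := 𝟭 C
  isEquivalence := inferInstance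
  additive := inferInstance
  linear := inferInstance
  δ g := NatIso.ofComponents (fun X => Iso.refl _) (by intros; simp)
  compat g h X := by simp

/-- The composite `(F, δ)(F', δ') = (F F', (δ_g F' ∘ F δ'_g)_g)`. -/
def comp (E E' : EquivariantAutoequivalence A) : EquivariantAutoequivalence A where
  F := E'.F ⋙ E.F
  isEquivalence := inferInstance
  additive := inferInstance
  linear := inferInstance
  δ g := NatIso.ofComponents
    (fun X => E.F.mapIso ((E'.δ g).app X) ≪≫ (E.δ g).app (E'.F.obj X))
    (by
      intro X Y f
      have h1 := (E'.δ g).hom.naturality f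
      have h2 := (E.δ g).hom.naturality (E'.F.map f)
      simp only [Functor.comp_map] at h1 h2
      simp only [Functor.comp_map, Iso.trans_hom, Functor.mapIso_hom, Iso.app_hom,
        Category.assoc]
      rw [← h2, ← Functor.map_comp_assoc, h1, Functor.map_comp_assoc])
  compat g h X := by
    have h1 := E'.compat g h X
    have h2 := E.compat g h (E'.F.obj X)
    have h3 := (E.δ g).hom.naturality ((E'.δ h).hom.app X)
    simp only [Functor.comp_map] at h3
    simp only [NatIso.ofComponents_hom_app, Iso.trans_hom, Functor.mapIso_hom, Iso.app_hom,
      Functor.comp_map, Functor.map_comp, Category.assoc, Functor.comp_obj] at *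
    rw [← Functor.map_comp_assoc, h1]
    simp only [Functor.map_comp, Category.assoc, h2]
    rw [reassoc_of% h3]

/-- The components `F F⁻¹ X ≅ X` of the counit of an equivariant autoequivalence. -/
noncomputable def cIso (E : EquivariantAutoequivalence A) (X : C) :
    E.F.obj (E.F.inv.obj X) ≅ X :=
  E.F.asEquivalence.counitIso.app X

lemma counit_naturality (E : EquivariantAutoequivalence A) {X Y : C} (f : X ⟶ Y) :
    E.F.map (E.F.inv.map f) ≫ (E.cIso Y).hom = (E.cIso X).hom ≫ f :=
  E.F.asEquivalence.counitIso.hom.naturality f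

lemma counit_inv_naturality (E : EquivariantAutoequivalence A) {X Y : C} (f : X ⟶ Y) :
    f ≫ (E.cIso Y).inv = (E.cIso X).inv ≫ E.F.map (E.F.inv.map f) :=
  E.F.asEquivalence.counitIso.inv.naturality f

/-- The components of the equivariant structure on a quasi-inverse. -/
noncomputable def inverseδApp (E : EquivariantAutoequivalence A) (g : G) (X : C) :
    E.F.inv.obj ((A.F g).obj X) ≅ (A.F g).obj (E.F.inv.obj X) :=
  E.F.preimageIso
    (E.cIso ((A.F g).obj X) ≪≫
      (A.F g).mapIso (E.cIso X).symm ≪≫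
      ((E.δ g).app (E.F.inv.obj X)).symm)

lemma map_inverseδApp (E : EquivariantAutoequivalence A) (g : G) (X : C) :
    E.F.map (E.inverseδApp g X).hom =
      (E.cIso ((A.F g).obj X)).hom ≫
        (A.F g).map (E.cIso X).inv ≫
          (E.δ g).inv.app (E.F.inv.obj X) := by
  simp [inverseδApp]

lemma δ_inv_naturality (E : EquivariantAutoequivalence A) (g : G) {X Y : C} (f : X ⟶ Y) :
    (A.F g).map (E.F.map f) ≫ (E.δ g).inv.app Y =
      (E.δ g).inv.app X ≫ E.F.map ((A.F g).map f) :=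
  (E.δ g).inv.naturality f

lemma ε_naturality (g h : G) {X Y : C} (f : X ⟶ Y) :
    (A.F g).map ((A.F h).map f) ≫ (A.ε g h).hom.app Y =
      (A.ε g h).hom.app X ≫ (A.F (g * h)).map f :=
  (A.ε g h).hom.naturality f

lemma compat_inv (E : EquivariantAutoequivalence A) (g h : G) (X : C) :
    (A.F g).map ((E.δ h).inv.app X) ≫ (E.δ g).inv.app ((A.F h).obj X) ≫
        E.F.map ((A.ε g h).hom.app X) =
      (A.ε g h).hom.app (E.F.obj X) ≫ (E.δ (g * h)).inv.app X := by
  rw [← cancel_mono ((E.δ (g * h)).hom.app X)]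
  simp only [Category.assoc, E.compat]
  simp [← Functor.map_comp_assoc]

/-- A quasi-inverse of an equivariant autoequivalence, with its induced equivariant structure. -/
noncomputable def inverse (E : EquivariantAutoequivalence A) : EquivariantAutoequivalence A where
  F := E.F.inv
  isEquivalence := inferInstance
  additive :=
    haveI : E.F.asEquivalence.functor.Additive := E.additive
    inferInstanceAs (E.F.asEquivalence.inverse.Additive)
  linear :=
    haveI : E.F.asEquivalence.functor.Additive := E.additive
    haveI : E.F.asEquivalence.functor.Linear k := E.linear
    inferInstanceAs (E.F.asEquivalence.inverse.Linear k)
  δ g := NatIso.ofComponents (fun X => E.inverseδApp g X) (by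
    intro X Y f
    apply E.F.map_injective
    simp only [Functor.comp_map, Functor.comp_obj, Functor.map_comp, map_inverseδApp,
      Category.assoc]
    rw [reassoc_of% (E.counit_naturality ((A.F g).map f)), ← E.δ_inv_naturality,
      ← Functor.map_comp_assoc, ← Functor.map_comp_assoc, E.counit_inv_naturality])
  compat g h X := by
    apply E.F.map_injective
    simp only [NatIso.ofComponents_hom_app, Functor.map_comp, map_inverseδApp, Category.assoc]
    rw [← reassoc_of% (E.δ_inv_naturality g (E.inverseδApp h X).hom), map_inverseδApp,
      reassoc_of% (E.counit_naturality ((A.ε g h).hom.app X))]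
    simp only [Functor.map_comp, Category.assoc, E.compat_inv]
    rw [← reassoc_of% (ε_naturality (A := A) g h), ← Functor.map_comp_assoc (A.F g)]
    simp

lemma inverse_comp (E : EquivariantAutoequivalence A) :
    (E.comp E.inverse).Isomorphic (one A) := by
  refine ⟨NatIso.ofComponents (fun X => E.cIso X) (fun f => E.counit_naturality f),
    fun g X => ?_⟩
  have := E.map_inverseδApp g X
  simp only [comp, inverse, one, NatIso.ofComponents_hom_app, Iso.trans_hom, Functor.mapIso_hom,
    Iso.app_hom, Category.assoc, this]
  simp [← Functor.map_comp]

lemma Isomorphic.comp {E E' D D' : EquivariantAutoequivalence A} (h : E.Isomorphic E')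
    (h' : D.Isomorphic D') : (E.comp D).Isomorphic (E'.comp D') := by
  obtain ⟨φ, hφ⟩ := h
  obtain ⟨ψ, hψ⟩ := h'
  refine ⟨NatIso.hcomp ψ φ, fun g X => ?_⟩
  have h1 : E.F.map ((A.F g).map (ψ.hom.app X)) ≫ (E.δ g).hom.app (D'.F.obj X) =
      (E.δ g).hom.app (D.F.obj X) ≫ (A.F g).map (E.F.map (ψ.hom.app X)) :=
    (E.δ g).hom.naturality (ψ.hom.app X)
  have h2 := φ.hom.naturality ((D'.δ g).hom.app X)
  have h3 := hφ g (D'.F.obj X)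
  have h4 := hψ g X
  simp only [EquivariantAutoequivalence.comp, NatIso.ofComponents_hom_app, Iso.trans_hom,
    Functor.mapIso_hom, Iso.app_hom, NatIso.hcomp, NatTrans.hcomp_app, Functor.comp_obj,
    Functor.map_comp, Category.assoc] at *
  have h5 := φ.hom.naturality (ψ.hom.app ((A.F g).obj X))
  have h6 := φ.hom.naturality (ψ.hom.app X)
  rw [← Functor.map_comp, ← h6, Functor.map_comp, ← reassoc_of% h1, h3,
    ← Functor.map_comp_assoc, h4, Functor.map_comp_assoc, reassoc_of% h2, reassoc_of% h5]

lemma comp_assoc (E E' E'' : EquivariantAutoequivalence A) :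
    ((E.comp E').comp E'').Isomorphic (E.comp (E'.comp E'')) :=
  ⟨NatIso.ofComponents (fun X => Iso.refl _) (by intros; simp [comp]),
    fun g X => by simp [comp]⟩

lemma comp_one (E : EquivariantAutoequivalence A) : (E.comp (one A)).Isomorphic E :=
  ⟨NatIso.ofComponents (fun X => Iso.refl _) (by intros; simp [comp, one]),
    fun g X => by simp [comp, one]⟩

end EquivariantAutoequivalence

namespace LinearAction

open EquivariantAutoequivalence

/-- The group `Aut(C; G)` of isomorphism classes of `k`-linear equivariant autoequivalences;
its multiplication is `[F, δ] [F', δ'] = [(F, δ)(F', δ')]`. -/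
def AutGroup (A : LinearAction k G C) := Quotient (setoid A)

/-- The class `[F, δ]` in `Aut(C; G)`. -/
def cls {A : LinearAction k G C} (E : EquivariantAutoequivalence A) : A.AutGroup :=
  Quotient.mk (setoid A) E

instance (A : LinearAction k G C) : Mul A.AutGroup where
  mul := Quotient.map₂ comp (fun _ _ h _ _ h' => Isomorphic.comp h h')

instance (A : LinearAction k G C) : One A.AutGroup where
  one := cls (one A)

noncomputable instance (A : LinearAction k G C) : Inv A.AutGroup where
  inv x := cls (inverse x.out)

lemma cls_mul_cls {A : LinearAction k G C} (E E' : EquivariantAutoequivalence A) :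
    cls E * cls E' = cls (E.comp E') := rfl

lemma cls_eq_cls {A : LinearAction k G C} {E E' : EquivariantAutoequivalence A} :
    cls E = cls E' ↔ E.Isomorphic E' := Quotient.eq (r := setoid A)

lemma cls_surjective {A : LinearAction k G C} (x : A.AutGroup) : ∃ E, cls E = x :=
  Quotient.exists_rep x

noncomputable instance (A : LinearAction k G C) : Group A.AutGroup :=
  Group.ofRightAxioms
    (fun x y z => by
      obtain ⟨E, rfl⟩ := cls_surjective x
      obtain ⟨E', rfl⟩ := cls_surjective y
      obtain ⟨E'', rfl⟩ := cls_surjective z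
      exact cls_eq_cls.2 (comp_assoc E E' E''))
    (fun x => by
      obtain ⟨E, rfl⟩ := cls_surjective x
      exact cls_eq_cls.2 (comp_one E))
    (fun x => by
      have h : cls x.out = x := Quotient.out_eq x
      have h' : cls x.out * x⁻¹ = 1 := cls_eq_cls.2 (inverse_comp x.out)
      rwa [h] at h')

lemma cls_inv {A : LinearAction k G C} (E : EquivariantAutoequivalence A) :
    (cls E)⁻¹ = cls E.inverse :=
  inv_eq_of_mul_eq_one_right (cls_eq_cls.2 (inverse_comp E))

/-- `F_e` is isomorphic to the identity functor. -/
lemma nonempty_unitIso (A : LinearAction k G C) : Nonempty (A.F 1 ≅ 𝟭 C) := by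
  have e : A.F 1 ⋙ A.F 1 ≅ A.F 1 := A.ε 1 1 ≪≫ eqToIso (by rw [mul_one])
  let a := (A.F 1).asEquivalence
  exact ⟨(Functor.rightUnitor _).symm ≪≫ Functor.isoWhiskerLeft (A.F 1) a.unitIso ≪≫
    (Functor.associator _ _ _).symm ≪≫ Functor.isoWhiskerRight e a.inverse ≪≫ a.unitIso.symm⟩

/-- The subgroup `Act(C; G)` of `Aut(C; G)`: the classes `[F, δ]` with `F` isomorphic to `F_a`
for some `a ∈ G`. -/
noncomputable def act (A : LinearAction k G C) : Subgroup A.AutGroup where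
  carrier := {x | ∃ E : EquivariantAutoequivalence A, cls E = x ∧ ∃ a : G, Nonempty (E.F ≅ A.F a)}
  one_mem' := by
    obtain ⟨u⟩ := A.nonempty_unitIso
    exact ⟨one A, rfl, 1, ⟨u.symm⟩⟩
  mul_mem' := by
    rintro _ _ ⟨E, rfl, a, ⟨φ⟩⟩ ⟨E', rfl, b, ⟨ψ⟩⟩
    exact ⟨E.comp E', rfl, a * b, ⟨NatIso.hcomp ψ φ ≪≫ A.ε a b⟩⟩
  inv_mem' := by
    rintro _ ⟨E, rfl, a, ⟨φ⟩⟩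
    obtain ⟨u⟩ := A.nonempty_unitIso
    have e : A.F a ⋙ A.F a⁻¹ ≅ 𝟭 C := A.ε a⁻¹ a ≪≫ eqToIso (by rw [inv_mul_cancel]) ≪≫ u
    refine ⟨E.inverse, (cls_inv E).symm, a⁻¹, ⟨?_⟩⟩
    exact (Functor.rightUnitor _).symm ≪≫
      Functor.isoWhiskerLeft E.F.inv (e.symm ≪≫ Functor.isoWhiskerRight φ.symm _) ≪≫
      (Functor.associator _ _ _).symm ≪≫
      Functor.isoWhiskerRight E.F.asEquivalence.counitIso _ ≪≫ Functor.leftUnitor _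

/-- Membership in `Act(C; G)` does not depend on the representative. -/
lemma cls_mem_act_iff {A : LinearAction k G C} (E : EquivariantAutoequivalence A) :
    cls E ∈ A.act ↔ ∃ a : G, Nonempty (E.F ≅ A.F a) := by
  constructor
  · rintro ⟨E', h, a, ⟨φ⟩⟩
    obtain ⟨ψ, -⟩ := cls_eq_cls.1 h
    exact ⟨a, ⟨ψ.symm ≪≫ φ⟩⟩
  · intro h
    exact ⟨E, rfl, h⟩

/-! ### The dual action -/

/-- The automorphism `F_χ (X, α) = (X, χ ⊗ α)` of the category of equivariant objects, where
`(χ ⊗ α)_g = χ(g⁻¹) α_g`; it is the identity on morphisms. -/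
@[simps]
def dualFunctor (A : LinearAction k G C) (χ : G →* kˣ) :
    EquivariantObject A ⥤ EquivariantObject A where
  obj P :=
    { X := P.X
      α := fun g =>
        { hom := (χ g⁻¹ : k) • (P.α g).hom
          inv := (χ g : k) • (P.α g).inv
          hom_inv_id := by simp [smul_smul]
          inv_hom_id := by simp [smul_smul] }
      rel := fun g h => by
        simp [P.rel, smul_smul, Functor.map_smul, mul_comm] }
  map a := { f := a.f, comm := fun g => by simp [a.comm] }

lemma smul_comm_iff {F : C ⥤ C} [F.Linear k] {X Y : C} (c : kˣ) {a : X ⟶ F.obj X}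
    {b : Y ⟶ F.obj Y} {f : X ⟶ Y} :
    f ≫ ((c : k) • b) = ((c : k) • a) ≫ F.map f ↔ f ≫ b = a ≫ F.map f := by
  rw [Linear.comp_smul, Linear.smul_comp]
  exact (smul_right_injective _ c.ne_zero).eq_iff

lemma mul_apply_smul (χ χ' : G →* kˣ) (g : G) {X Y : C} (a : X ⟶ Y) :
    ((χ * χ') g : k) • a = (χ g : k) • (χ' g : k) • a := by
  simp [smul_smul]

lemma apply_smul_inv_apply_smul (χ : G →* kˣ) (g : G) {X Y : C} (a : X ⟶ Y) :
    (χ g : k) • (χ⁻¹ g : k) • a = a := by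
  simp [smul_smul]

/-- The isomorphism `F_χ F_χ' ≅ F_{χχ'}`, which is the identity on underlying objects. -/
@[simps]
def dualIso (A : LinearAction k G C) (χ χ' : G →* kˣ) (P : EquivariantObject A) :
    (A.dualFunctor χ).obj ((A.dualFunctor χ').obj P) ≅ (A.dualFunctor (χ * χ')).obj P where
  hom :=
    { f := 𝟙 P.X
      comm := fun g => id_comm (F := A.F g) (mul_apply_smul χ χ' g⁻¹ (P.α g).hom) }
  inv :=
    { f := 𝟙 P.X
      comm := fun g => id_comm (F := A.F g) (mul_apply_smul χ χ' g⁻¹ (P.α g).hom).symm }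
  hom_inv_id := by
    ext
    exact Category.id_comp _
  inv_hom_id := by
    ext
    exact Category.id_comp _

instance (A : LinearAction k G C) (χ : G →* kˣ) : (A.dualFunctor χ).IsEquivalence where
  faithful := ⟨fun {_ _ a b} h => by
    have h' := congrArg EquivariantObject.Hom.f h
    exact EquivariantObject.hom_ext h'⟩
  full := ⟨fun {P Q} a =>
    ⟨{ f := a.f, comm := fun g => (smul_comm_iff (F := A.F g) (χ g⁻¹)).1 (a.comm g) }, rfl⟩⟩
  essSurj := ⟨fun Q => ⟨(A.dualFunctor χ⁻¹).obj Q, ⟨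
    { hom :=
        { f := 𝟙 Q.X
          comm := fun g => id_comm (F := A.F g)
            (apply_smul_inv_apply_smul χ g⁻¹ (Q.α g).hom).symm }
      inv :=
        { f := 𝟙 Q.X
          comm := fun g => id_comm (F := A.F g)
            (apply_smul_inv_apply_smul χ g⁻¹ (Q.α g).hom) }
      hom_inv_id := by
        ext
        exact Category.id_comp _
      inv_hom_id := by
        ext
        exact Category.id_comp _ }⟩⟩⟩

/-- The dual action of the character group `Hom(G, kˣ)` on the category of equivariant objects:
`χ` acts by `F_χ`, and the isomorphisms `F_χ F_χ' ≅ F_{χχ'}` are identities on the underlying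
objects. -/
@[simps]
def dual (A : LinearAction k G C) : LinearAction k (G →* kˣ) (EquivariantObject A) where
  F χ := A.dualFunctor χ
  isEquivalence χ := inferInstance
  additive χ := { map_add := rfl }
  linear χ := { map_smul := fun _ _ => rfl }
  ε χ χ' := NatIso.ofComponents (fun P => A.dualIso χ χ' P) (fun {P Q} a => by
    ext
    exact (Category.comp_id a.f).trans (Category.id_comp a.f).symm)
  cocycle χ χ' χ'' P := by
    ext
    simp only [NatIso.ofComponents_hom_app, EquivariantObject.comp_f,
      EquivariantObject.eqToHom_f, dualIso_hom_f, dualFunctor_map_f]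
    refine (Category.id_comp _).trans ((Category.id_comp _).trans ?_)
    exact (Category.id_comp (𝟙 P.X)).symm

end LinearAction

/-! ### Equivariantization -/

namespace EquivariantAutoequivalence

variable {A : LinearAction k G C}

/-- The endofunctor `(F, δ)^G` of the category of equivariant objects, sending `(X, α)` to
`(F X, (δ_g)_X ∘ F(α_g))` and `f` to `F f`. -/
@[simps]
def equivariantFunctor (E : EquivariantAutoequivalence A) :
    EquivariantObject A ⥤ EquivariantObject A where
  obj P :=
    { X := E.F.obj P.X
      α := fun g => E.F.mapIso (P.α g) ≪≫ (E.δ g).app P.X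
      rel := fun g h => by
        have h1 : E.F.map ((A.F g).map (P.α h).hom) ≫ (E.δ g).hom.app ((A.F h).obj P.X) =
            (E.δ g).hom.app P.X ≫ (A.F g).map (E.F.map (P.α h).hom) :=
          (E.δ g).hom.naturality (P.α h).hom
        have h2 := E.compat g h P.X
        simp only [Functor.comp_obj, Iso.trans_hom, Functor.mapIso_hom, Iso.app_hom, P.rel,
          Functor.map_comp, Category.assoc] at *
        rw [h2, reassoc_of% h1] }
  map {P Q} a :=
    { f := E.F.map a.f
      comm := fun g => by
        have h1 : E.F.map ((A.F g).map a.f) ≫ (E.δ g).hom.app Q.X =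
            (E.δ g).hom.app P.X ≫ (A.F g).map (E.F.map a.f) :=
          (E.δ g).hom.naturality a.f
        simp only [Functor.comp_obj, Iso.trans_hom, Functor.mapIso_hom, Iso.app_hom,
          Category.assoc] at *
        rw [← h1, ← Functor.map_comp_assoc, a.comm, Functor.map_comp_assoc] }

instance (E : EquivariantAutoequivalence A) : E.equivariantFunctor.Additive where
  map_add {P Q a b} := by
    ext
    exact E.F.map_add

instance (E : EquivariantAutoequivalence A) : E.equivariantFunctor.Linear k where
  map_smul {P Q} a c := by
    ext
    exact Functor.Linear.map_smul a.f c

instance (E : EquivariantAutoequivalence A) : E.equivariantFunctor.Faithful where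
  map_injective {P Q a b} h := by
    ext
    exact E.F.map_injective (congrArg (fun c => EquivariantObject.Hom.f c) h)

/-- The natural isomorphism `(F, δ)^G ≅ (F', δ')^G` given by an isomorphism
`(F, δ) ≅ (F', δ')`. -/
def equivariantFunctorIso {E E' : EquivariantAutoequivalence A} (φ : E.F ≅ E'.F)
    (hφ : ∀ (g : G) (X : C), (E.δ g).hom.app X ≫ (A.F g).map (φ.hom.app X) =
      φ.hom.app ((A.F g).obj X) ≫ (E'.δ g).hom.app X) :
    E.equivariantFunctor ≅ E'.equivariantFunctor :=
  NatIso.ofComponents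
    (fun P => EquivariantObject.isoMk (φ.app P.X) (fun g => by
      have h1 := φ.hom.naturality (P.α g).hom
      have h2 := hφ g P.X
      have h3 : φ.hom.app P.X ≫ E'.F.map (P.α g).hom ≫ (E'.δ g).hom.app P.X =
          (E.F.map (P.α g).hom ≫ (E.δ g).hom.app P.X) ≫ (A.F g).map (φ.hom.app P.X) := by
        rw [Category.assoc, h2, reassoc_of% h1]
      exact h3))
    (fun {P Q} a => by
      ext
      exact φ.hom.naturality a.f)

instance (E : EquivariantAutoequivalence A) : E.equivariantFunctor.Full where
  map_surjective {P Q} b := by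
    have hb : E.F.map (E.F.preimage b.f) = b.f := E.F.map_preimage b.f
    refine ⟨{ f := E.F.preimage b.f, comm := fun g => ?_ }, ?_⟩
    · apply E.F.map_injective
      have h1 : b.f ≫ E.F.map (Q.α g).hom ≫ (E.δ g).hom.app Q.X =
          (E.F.map (P.α g).hom ≫ (E.δ g).hom.app P.X) ≫ (A.F g).map b.f := b.comm g
      rw [← hb] at h1
      have h2 : E.F.map ((A.F g).map (E.F.preimage b.f)) ≫ (E.δ g).hom.app Q.X =
          (E.δ g).hom.app P.X ≫ (A.F g).map (E.F.map (E.F.preimage b.f)) :=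
        (E.δ g).hom.naturality (E.F.preimage b.f)
      rw [← cancel_mono ((E.δ g).hom.app Q.X)]
      rw [Functor.map_comp, Functor.map_comp, Category.assoc, Category.assoc, h2]
      exact h1.trans (Category.assoc _ _ _)
    · ext
      exact hb

instance (E : EquivariantAutoequivalence A) : E.equivariantFunctor.EssSurj where
  mem_essImage Q := by
    refine ⟨E.inverse.equivariantFunctor.obj Q,
      ⟨EquivariantObject.isoMk (E.cIso Q.X) (fun g => ?_)⟩⟩
    have h1 := E.counit_naturality (Q.α g).hom
    have h2 := E.map_inverseδApp g Q.X
    have h3 : (E.cIso Q.X).hom ≫ (Q.α g).hom =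
        (E.F.map (E.F.inv.map (Q.α g).hom ≫ (E.inverseδApp g Q.X).hom) ≫
          (E.δ g).hom.app (E.F.inv.obj Q.X)) ≫ (A.F g).map (E.cIso Q.X).hom := by
      have h4 : (A.F g).map (E.cIso Q.X).inv ≫ (A.F g).map (E.cIso Q.X).hom = 𝟙 _ := by
        rw [← Functor.map_comp, Iso.inv_hom_id, CategoryTheory.Functor.map_id]
      rw [← h1, Functor.map_comp, h2]
      simp only [Category.assoc, Iso.inv_hom_id_app_assoc, Functor.comp_obj]
      rw [h4, Category.comp_id]
    exact h3

instance (E : EquivariantAutoequivalence A) : E.equivariantFunctor.IsEquivalence where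

lemma smul_structure (E : EquivariantAutoequivalence A) (c : k) (g : G) {X : C}
    (a : X ⟶ (A.F g).obj X) :
    c • (E.F.map a ≫ (E.δ g).hom.app X) = E.F.map (c • a) ≫ (E.δ g).hom.app X := by
  rw [Functor.map_smul, Linear.smul_comp]

/-- `(F, δ)^G` as a `Ĝ`-equivariant autoequivalence for the dual action; the isomorphisms
`(F, δ)^G F_χ ≅ F_χ (F, δ)^G` are identities on the underlying objects. -/
def equivariantization (E : EquivariantAutoequivalence A) :
    EquivariantAutoequivalence A.dual where
  F := E.equivariantFunctor
  isEquivalence := inferInstance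
  additive := inferInstance
  linear := inferInstance
  δ χ := NatIso.ofComponents
    (fun P =>
      { hom := { f := 𝟙 (E.F.obj P.X)
                 comm := fun g => id_comm (F := A.F g)
                   (E.smul_structure (χ g⁻¹ : k) g (P.α g).hom) }
        inv := { f := 𝟙 (E.F.obj P.X)
                 comm := fun g => id_comm (F := A.F g)
                   (E.smul_structure (χ g⁻¹ : k) g (P.α g).hom).symm }
        hom_inv_id := by
          ext
          exact Category.id_comp _
        inv_hom_id := by
          ext
          exact Category.id_comp _ })
    (fun {P Q} a => by
      ext
      exact (Category.comp_id (E.F.map a.f)).trans (Category.id_comp (E.F.map a.f)).symm)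
  compat χ χ' P := by
    ext
    have h : E.F.map (𝟙 P.X) = 𝟙 (E.F.obj P.X) := E.F.map_id P.X
    exact (Category.comp_id _).trans (h.trans
      ((Category.id_comp (𝟙 (E.F.obj P.X) ≫ 𝟙 (E.F.obj P.X))).trans
        (Category.id_comp (𝟙 (E.F.obj P.X)))).symm)

/-- Isomorphic equivariant autoequivalences have isomorphic equivariantizations. -/
lemma Isomorphic.equivariantization {E E' : EquivariantAutoequivalence A}
    (h : E.Isomorphic E') : E.equivariantization.Isomorphic E'.equivariantization := by
  obtain ⟨φ, hφ⟩ := h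
  refine ⟨equivariantFunctorIso φ hφ, fun χ P => ?_⟩
  ext
  exact (Category.id_comp (φ.hom.app P.X)).trans (Category.comp_id (φ.hom.app P.X)).symm

lemma equivariantization_comp_aux (E E' : EquivariantAutoequivalence A)
    (P : EquivariantObject A) (g : G) :
    E.F.map (E'.F.map (P.α g).hom ≫ (E'.δ g).hom.app P.X) ≫ (E.δ g).hom.app (E'.F.obj P.X) =
      E.F.map (E'.F.map (P.α g).hom) ≫ ((E.comp E').δ g).hom.app P.X := by
  simp [comp]

lemma equivariantization_comp (E E' : EquivariantAutoequivalence A) :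
    (E.comp E').equivariantization.Isomorphic
      (E.equivariantization.comp E'.equivariantization) := by
  refine ⟨NatIso.ofComponents
    (fun P =>
      { hom := { f := 𝟙 (E.F.obj (E'.F.obj P.X))
                 comm := fun g => id_comm (F := A.F g) (equivariantization_comp_aux E E' P g) }
        inv := { f := 𝟙 (E.F.obj (E'.F.obj P.X))
                 comm := fun g => id_comm (F := A.F g)
                   (equivariantization_comp_aux E E' P g).symm }
        hom_inv_id := by
          ext
          exact Category.id_comp _
        inv_hom_id := by
          ext
          exact Category.id_comp _ })
    (fun {P Q} a => by
      ext
      exact (Category.comp_id (E.F.map (E'.F.map a.f))).trans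
        (Category.id_comp (E.F.map (E'.F.map a.f))).symm), fun χ P => ?_⟩
  ext
  have h : E.F.map (𝟙 (E'.F.obj P.X)) = 𝟙 (E.F.obj (E'.F.obj P.X)) := E.F.map_id _
  refine congrArg (𝟙 (E.F.obj (E'.F.obj P.X)) ≫ ·) ?_
  exact (Eq.trans (congrArg (· ≫ 𝟙 (E.F.obj (E'.F.obj P.X))) h) (Category.id_comp _)).symm

end EquivariantAutoequivalence

/-- The equivariantization homomorphism `(-)^G : Aut(C; G) → Aut(C^G; Ĝ)`,
`[F, δ] ↦ [(F, δ)^G]`. -/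
noncomputable def equivariantizationHom (A : LinearAction k G C) :
    A.AutGroup →* A.dual.AutGroup :=
  MonoidHom.mk'
    (Quotient.map EquivariantAutoequivalence.equivariantization
      (fun _ _ h => EquivariantAutoequivalence.Isomorphic.equivariantization h))
    (fun x y => by
      obtain ⟨E, rfl⟩ := LinearAction.cls_surjective x
      obtain ⟨E', rfl⟩ := LinearAction.cls_surjective y
      exact LinearAction.cls_eq_cls.2
        (EquivariantAutoequivalence.equivariantization_comp E E'))

lemma equivariantizationHom_cls {A : LinearAction k G C} (E : EquivariantAutoequivalence A) :
    equivariantizationHom A (LinearAction.cls E) = LinearAction.cls E.equivariantization := rfl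

/-- `G` splits over `k`: the group algebra `kG` is isomorphic to a finite product of copies
of `k`. -/
def SplitsOver (k : Type w) [Field k] (G : Type x) [Group G] : Prop :=
  ∃ n : ℕ, Nonempty (MonoidAlgebra k G ≃ₐ[k] (Fin n → k))

/-- `Z(C) = k`: the structure map from `k` to the center of `C` (the natural endomorphisms of
the identity functor) is bijective. -/
def CenterEqScalars (k : Type w) [Field k] (C : Type u) [Category.{v} C] [Preadditive C]
    [Linear k C] : Prop :=
  Function.Bijective (Linear.toCatCenter k C)

end
end Equivariantization

/-!
If `Z(C) = k`, an equivariant structure on a functor isomorphic to `F_a` differs from the canonical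
structure `F_a F_g ≅ F_{ag} ≅ F_g F_a` by a scalar `χ(g)` for each `g`, and `χ` is a character; so
`Act(C; G)` consists of the classes of translations by `a ∈ G` twisted by characters `χ`. The
isomorphisms `α_a⁻¹ : F_a X ≅ X` show that equivariantization sends the translation by `a` twisted
by `χ` to the translation by `χ⁻¹` twisted by evaluation at `a⁻¹`. As `G` splits over `k`, every
character of `Ĝ` is an evaluation, which gives surjectivity.

For injectivity, let `Φ : (F, δ)^G ≅ Id` commute with the dual action. At the induced object
`⨁_g F_g X` it commutes with the scaling of each `F_g X` by `χ(g)`, for every character `χ`; since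
the characters separate the elements of `G`, it preserves the summand `F_1 X ≅ X`, and its
restriction there is an isomorphism `(F, δ) ≅ (Id, id)`.
-/

namespace Equivariantization

universe w x v u

/-! ### Characters -/

section Characters

variable {k : Type*} [Field k] {G : Type*}

lemma SplitsOver.exists_character_apply_ne_one [Group G] (hG : SplitsOver k G) {g : G}
    (hg : g ≠ 1) : ∃ χ : G →* kˣ, χ g ≠ 1 := by
  obtain ⟨n, ⟨e⟩⟩ := hG
  let ρ : G →* Fin n → k := (e : MonoidAlgebra k G →* Fin n → k).comp (MonoidAlgebra.of k G)
  have hρ : ρ g ≠ 1 := fun h =>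
    hg (MonoidAlgebra.of_injective (e.injective (h.trans (map_one ρ).symm)))
  obtain ⟨i, hi⟩ := Function.ne_iff.1 hρ
  exact ⟨((Pi.evalMonoidHom _ i).comp ρ).toHomUnits, fun h => hi (congrArg Units.val h)⟩

lemma linearIndependent_characters (k : Type*) [Field k] (G : Type*) [Monoid G] :
    LinearIndependent k fun (χ : G →* kˣ) (g : G) => (χ g : k) :=
  (linearIndependent_monoidHom G k).comp (fun χ : G →* kˣ => (Units.coeHom k).comp χ)
    fun _ _ h => MonoidHom.ext fun g => Units.ext (DFunLike.congr_fun h g)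

instance [Monoid G] [Finite G] : Finite (G →* kˣ) :=
  (linearIndependent_characters k G).finite

lemma card_characters_le (k : Type*) [Field k] (G : Type*) [Monoid G] [Finite G] :
    Nat.card (G →* kˣ) ≤ Nat.card G := by
  have := Fintype.ofFinite G
  have := Fintype.ofFinite (G →* kˣ)
  simpa [Nat.card_eq_fintype_card] using
    (linearIndependent_characters k G).fintype_card_le_finrank

lemma SplitsOver.eval_bijective [CommGroup G] [Finite G] (hG : SplitsOver k G) :
    Function.Bijective (MonoidHom.eval : G →* (G →* kˣ) →* kˣ) := by
  have hinj : Function.Injective (MonoidHom.eval : G →* (G →* kˣ) →* kˣ) := by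
    refine (injective_iff_map_eq_one _).2 fun g hg => ?_
    by_contra hne
    obtain ⟨χ, hχ⟩ := hG.exists_character_apply_ne_one hne
    exact hχ (DFunLike.congr_fun hg χ)
  exact (Nat.bijective_iff_injective_and_card _).2 ⟨hinj,
    (Nat.card_le_card_of_injective _ hinj).antisymm
      ((card_characters_le k (G →* kˣ)).trans (card_characters_le k G))⟩

end Characters

/-! ### Functors and biproducts -/

instance {C D : Type*} [Category* C] [Category* D] [Preadditive C] [Preadditive D] (F : C ⥤ D)
    [F.IsEquivalence] (J : Type*) [Finite J] : PreservesBiproductsOfShape J F :=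
  preservesBiproductsOfShape_of_preservesProductsOfShape F

section Biproduct

variable {C D : Type*} [Category* C] [Category* D] [HasZeroMorphisms C] [HasZeroMorphisms D]
  {J : Type*} {f : J → C} [HasBiproduct f] (F : C ⥤ D) [F.PreservesZeroMorphisms]
  [PreservesBiproduct f F]

lemma ι_comp_mapBiproduct_inv (j : J) :
    biproduct.ι (F.obj ∘ f) j ≫ (F.mapBiproduct f).inv = F.map (biproduct.ι f j) := by
  rw [Functor.mapBiproduct_inv, biproduct.ι_desc]

lemma map_biproduct_hom_ext {Y : D} {a b : F.obj (⨁ f) ⟶ Y}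
    (h : ∀ j, F.map (biproduct.ι f j) ≫ a = F.map (biproduct.ι f j) ≫ b) : a = b := by
  rw [← cancel_epi (F.mapBiproduct f).inv]
  refine biproduct.hom_ext' _ _ fun j => ?_
  simpa only [← Category.assoc, ι_comp_mapBiproduct_inv] using h j

end Biproduct

variable {k : Type w} [Field k] {C : Type u} [Category.{v} C] [Preadditive C] [Linear k C]

/-! ### Natural isomorphisms in the presence of a scalar center -/

namespace CenterEqScalars

variable {D : Type*} [Category* D] [Preadditive D] [Linear k D] {F F' : C ⥤ D}

lemma eq_of_smul_app_eq (hC : CenterEqScalars k C) [F.Linear k] [F.Faithful] (ψ : F ≅ F')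
    {c d : k} (h : ∀ X, c • ψ.hom.app X = d • ψ.hom.app X) : c = d := by
  refine hC.1 (CatCenter.ext _ _ fun X => F.map_injective ?_)
  change F.map (c • 𝟙 X) = F.map (d • 𝟙 X)
  rw [F.map_smul, F.map_smul, F.map_id, ← ψ.hom_inv_id_app X, ← Linear.smul_comp, h,
    Linear.smul_comp]

lemma exists_eq_smul_id (hC : CenterEqScalars k C) [F.Linear k] [F.Full] [F.Faithful]
    (θ : F ⟶ F) : ∃ c : k, ∀ X, θ.app X = c • 𝟙 (F.obj X) := by
  obtain ⟨c, hc⟩ := hC.2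
    { app X := F.preimage (θ.app X)
      naturality X Y f := F.map_injective (by simp) }
  refine ⟨c, fun X => ?_⟩
  have hX : c • 𝟙 X = F.preimage (θ.app X) := congrArg (fun z => CatCenter.app z X) hc
  rw [← F.map_preimage (θ.app X), ← hX, F.map_smul, F.map_id]

lemma exists_unit_smul (hC : CenterEqScalars k C) [F.Linear k] [F.Full] [F.Faithful]
    (φ ψ : F ≅ F') : ∃ c : kˣ, ∀ X, φ.hom.app X = (c : k) • ψ.hom.app X := by
  obtain ⟨c, hc⟩ := hC.exists_eq_smul_id (φ ≪≫ ψ.symm).hom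
  obtain ⟨d, hd⟩ := hC.exists_eq_smul_id (ψ ≪≫ φ.symm).hom
  have hc' (X : C) : φ.hom.app X = c • ψ.hom.app X := by
    simpa using congrArg (· ≫ ψ.hom.app X) (hc X)
  have hd' (X : C) : ψ.hom.app X = d • φ.hom.app X := by
    simpa using congrArg (· ≫ φ.hom.app X) (hd X)
  have hcd : c * d = 1 := hC.eq_of_smul_app_eq φ fun X => by
    rw [mul_smul, ← hd', ← hc', one_smul]
  exact ⟨Units.mkOfMulEqOne c d hcd, hc'⟩

end CenterEqScalars

/-! ### Twisting by a character -/

namespace EquivariantAutoequivalence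

variable {G : Type x} [Group G] {A : LinearAction k G C}

/-- The twist `(F, (χ(g) δ_g)_g)` of an equivariant autoequivalence `(F, δ)` by a character `χ`. -/
def twist (E : EquivariantAutoequivalence A) (χ : G →* kˣ) : EquivariantAutoequivalence A where
  F := E.F
  isEquivalence := inferInstance
  additive := inferInstance
  linear := inferInstance
  δ g := NatIso.ofComponents
    (fun X =>
      { hom := (χ g : k) • (E.δ g).hom.app X
        inv := (χ g⁻¹ : k) • (E.δ g).inv.app X
        hom_inv_id := by simp [smul_smul]
        inv_hom_id := by simp [smul_smul] })
    (fun f => by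
      have h := (E.δ g).hom.naturality f
      dsimp only at h ⊢
      rw [Linear.comp_smul, Linear.smul_comp, h])
  compat g h X := by
    dsimp only [NatIso.ofComponents_hom_app]
    rw [Linear.comp_smul, E.compat, Functor.map_smul]
    simp only [Linear.smul_comp, Linear.comp_smul, smul_smul, map_mul, Units.val_mul, mul_comm]

/-- Comparing the two isomorphisms `F F_g ≅ F_g F'` that `φ` induces gives the character. -/
lemma exists_isomorphic_twist (hC : CenterEqScalars k C) (E E' : EquivariantAutoequivalence A)
    (φ : E.F ≅ E'.F) : ∃ χ : G →* kˣ, E.Isomorphic (E'.twist χ) := by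
  choose c hc using fun g => hC.exists_unit_smul
    (E.δ g ≪≫ Functor.isoWhiskerRight φ (A.F g)) (Functor.isoWhiskerLeft (A.F g) φ ≪≫ E'.δ g)
  have hc (g : G) (X : C) : (E.δ g).hom.app X ≫ (A.F g).map (φ.hom.app X) =
      (c g : k) • (φ.hom.app ((A.F g).obj X) ≫ (E'.δ g).hom.app X) := hc g X
  have c_mul (g h : G) : c (g * h) = c g * c h := by
    refine Units.ext (hC.eq_of_smul_app_eq (Functor.isoWhiskerRight (A.ε g h) E.F ≪≫
      Functor.isoWhiskerLeft (A.F (g * h)) φ ≪≫ E'.δ (g * h)) fun X => ?_)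
    change (c (g * h) : k) • (E.F.map ((A.ε g h).hom.app X) ≫ φ.hom.app _ ≫ _) =
      _ • (E.F.map ((A.ε g h).hom.app X) ≫ φ.hom.app _ ≫ _)
    calc _ = (E.F.map ((A.ε g h).hom.app X) ≫ (E.δ (g * h)).hom.app X) ≫
          (A.F (g * h)).map (φ.hom.app X) := by
          rw [← Linear.comp_smul, ← hc, Category.assoc]
      _ = (E.δ g).hom.app ((A.F h).obj X) ≫
          (A.F g).map ((E.δ h).hom.app X ≫ (A.F h).map (φ.hom.app X)) ≫
            (A.ε g h).hom.app (E'.F.obj X) := by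
          rw [E.compat, Functor.map_comp]
          simp only [Category.assoc, ε_naturality]
      _ = (c h : k) • (((E.δ g).hom.app ((A.F h).obj X) ≫
          (A.F g).map (φ.hom.app ((A.F h).obj X))) ≫ (A.F g).map ((E'.δ h).hom.app X) ≫
            (A.ε g h).hom.app (E'.F.obj X)) := by
          rw [hc, Functor.map_smul, Functor.map_comp]
          simp only [Linear.smul_comp, Linear.comp_smul, Category.assoc]
      _ = ((c g : k) * c h) • (φ.hom.app ((A.F g).obj ((A.F h).obj X)) ≫
          E'.F.map ((A.ε g h).hom.app X) ≫ (E'.δ (g * h)).hom.app X) := by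
          rw [hc, E'.compat, Linear.smul_comp, smul_smul, mul_comm, Category.assoc]
      _ = _ := by
          have h := φ.hom.naturality ((A.ε g h).hom.app X)
          dsimp only [Functor.comp_obj] at h ⊢
          rw [reassoc_of% h, Units.val_mul]
  exact ⟨MonoidHom.mk' c c_mul, φ, fun g X => (hc g X).trans (Linear.comp_smul _ _ _ _ _ _).symm⟩

end EquivariantAutoequivalence

/-! ### Composition isomorphisms -/

namespace LinearAction

variable {G : Type x} [Group G] (A : LinearAction k G C)

/-- The isomorphism `F_g F_h ≅ F_m` for `g * h = m`. Carrying the equation as an argument keeps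
`eqToHom`s out of the coherence computations. -/
def mulIso {g h m : G} (e : g * h = m) : A.F h ⋙ A.F g ≅ A.F m :=
  A.ε g h ≪≫ eqToIso (congrArg A.F e)

lemma mulIso_rfl (g h : G) : A.mulIso (rfl : g * h = g * h) = A.ε g h := by
  simp [mulIso]

lemma mulIso_naturality {g h m : G} (e : g * h = m) {X Y : C} (f : X ⟶ Y) :
    (A.F g).map ((A.F h).map f) ≫ (A.mulIso e).hom.app Y =
      (A.mulIso e).hom.app X ≫ (A.F m).map f :=
  (A.mulIso e).hom.naturality f

lemma mulIso_assoc {g h l gh hl n : G} (e₁ : g * h = gh) (e₂ : gh * l = n) (e₃ : h * l = hl)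
    (e₄ : g * hl = n) (X : C) :
    (A.mulIso e₁).hom.app ((A.F l).obj X) ≫ (A.mulIso e₂).hom.app X =
      (A.F g).map ((A.mulIso e₃).hom.app X) ≫ (A.mulIso e₄).hom.app X := by
  subst e₁ e₃ e₄
  rw [mulIso_rfl, mulIso_rfl, mulIso_rfl, ← A.cocycle]
  simp [mulIso]

variable {A} in
lemma dual_mulIso_hom_app_f {χ η ψ : G →* kˣ} (e : χ * η = ψ) (P : EquivariantObject A) :
    ((A.dual.mulIso e).hom.app P).f = 𝟙 P.X := by
  subst e
  rw [mulIso_rfl]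
  rfl

end LinearAction

namespace EquivariantObject

variable {G : Type x} [Group G] {A : LinearAction k G C}

lemma α_mul (P : EquivariantObject A) {g h m : G} (e : g * h = m) :
    (P.α g).hom ≫ (A.F g).map (P.α h).hom ≫ (A.mulIso e).hom.app P.X = (P.α m).hom := by
  subst e
  rw [A.mulIso_rfl, P.rel]

lemma mulIso_comp_α_inv (P : EquivariantObject A) {g h m : G} (e : g * h = m) :
    (A.mulIso e).hom.app P.X ≫ (P.α m).inv = (A.F g).map (P.α h).inv ≫ (P.α g).inv := by
  rw [Iso.comp_inv_eq, ← P.α_mul e, Category.assoc, Iso.inv_hom_id_assoc,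
    ← Functor.map_comp_assoc, Iso.inv_hom_id, CategoryTheory.Functor.map_id,
    Category.id_comp]

/-- A morphism of equivariant objects from its compatibility with the inverse structure maps. -/
def homMkOfInv {P Q : EquivariantObject A} (f : P.X ⟶ Q.X)
    (comm : ∀ g, (P.α g).inv ≫ f = (A.F g).map f ≫ (Q.α g).inv) : P ⟶ Q where
  f := f
  comm g := by rw [← Iso.inv_comp_eq, reassoc_of% comm, Iso.inv_hom_id, Category.comp_id]

end EquivariantObject

/-! ### Translations -/

namespace LinearAction

variable {G : Type x} [CommGroup G]

section

variable (A : LinearAction k G C)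

/-- The canonical isomorphism `F_a F_g ≅ F_{ag} = F_{ga} ≅ F_g F_a`. -/
def commIso (a g : G) : A.F g ⋙ A.F a ≅ A.F a ⋙ A.F g :=
  A.mulIso rfl ≪≫ (A.mulIso (mul_comm g a)).symm

lemma commIso_comp_mulIso {a g m : G} (e : g * a = m) (e' : a * g = m) (X : C) :
    (A.commIso a g).hom.app X ≫ (A.mulIso e).hom.app X = (A.mulIso e').hom.app X := by
  subst e'
  simp [commIso]

lemma map_mulIso_comp_commIso (a : G) {g h m : G} (e : g * h = m) (X : C) :
    (A.F a).map ((A.mulIso e).hom.app X) ≫ (A.commIso a m).hom.app X =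
      (A.commIso a g).hom.app ((A.F h).obj X) ≫ (A.F g).map ((A.commIso a h).hom.app X) ≫
        (A.mulIso e).hom.app ((A.F a).obj X) := by
  have e₁ : g * (a * h) = a * m := by rw [← e, mul_left_comm]
  have e₂ : a * g * h = a * m := by rw [mul_assoc, e]
  rw [← cancel_mono ((A.mulIso (mul_comm m a)).hom.app X)]
  simp only [Category.assoc]
  rw [A.commIso_comp_mulIso _ rfl, A.mulIso_assoc e (mul_comm m a) (mul_comm h a) e₁,
    ← Functor.map_comp_assoc, A.commIso_comp_mulIso _ rfl,
    ← A.mulIso_assoc (mul_comm g a) e₂ rfl e₁, reassoc_of% (A.commIso_comp_mulIso _ rfl),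
    A.mulIso_assoc _ _ e]

/-- The functor `F_a` as an equivariant autoequivalence, with the canonical structure
`F_a F_g ≅ F_g F_a`. -/
def translation (a : G) : EquivariantAutoequivalence A where
  F := A.F a
  isEquivalence := inferInstance
  additive := inferInstance
  linear := inferInstance
  δ g := A.commIso a g
  compat g h X := by
    simpa only [mulIso_rfl] using A.map_mulIso_comp_commIso a (rfl : g * h = g * h) X

end

variable {A : LinearAction k G C}

lemma dual_commIso_hom_app_f (χ η : G →* kˣ) (P : EquivariantObject A) :
    ((A.dual.commIso χ η).hom.app P).f = 𝟙 P.X := by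
  have h := congrArg EquivariantObject.Hom.f
    (A.dual.commIso_comp_mulIso (mul_comm η χ) rfl P)
  rw [EquivariantObject.comp_f, dual_mulIso_hom_app_f, dual_mulIso_hom_app_f] at h
  exact (Category.comp_id _).symm.trans h

lemma α_comp_map_α_comp_commIso (P : EquivariantObject A) (a g : G) :
    (P.α a).hom ≫ (A.F a).map (P.α g).hom ≫ (A.commIso a g).hom.app P.X =
      (P.α g).hom ≫ (A.F g).map (P.α a).hom := by
  rw [← cancel_mono ((A.mulIso (mul_comm g a)).hom.app P.X)]
  simp only [Category.assoc]
  rw [A.commIso_comp_mulIso _ rfl, P.α_mul, P.α_mul]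

/-- The isomorphisms `α_a⁻¹ : F_a X ≅ X` are natural in the equivariant object `(X, α)`, but
compatible with the equivariant structures only up to the characters `χ` and `χ ↦ χ(a⁻¹)`. -/
lemma translation_twist_equivariantization (a : G) (χ : G →* kˣ) :
    ((A.translation a).twist χ).equivariantization.Isomorphic
      ((A.dual.translation χ⁻¹).twist (MonoidHom.eval a⁻¹)) := by
  refine ⟨NatIso.ofComponents (fun P => EquivariantObject.isoMk (P.α a).symm (fun g => ?_))
    (fun {P Q} f => ?_), fun η P => ?_⟩
  · have h := α_comp_map_α_comp_commIso P a g
    change (P.α a).inv ≫ (((χ⁻¹ g⁻¹ : kˣ) : k) • (P.α g).hom) =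
      ((A.F a).map (P.α g).hom ≫ ((χ g : k) • (A.commIso a g).hom.app P.X)) ≫
        (A.F g).map (P.α a).inv
    rw [Iso.inv_comp_eq, Linear.comp_smul, Linear.smul_comp, Linear.comp_smul, Category.assoc,
      reassoc_of% h, ← Functor.map_comp]
    simp
  · ext
    change (A.F a).map f.f ≫ (Q.α a).inv = (P.α a).inv ≫ f.f
    rw [Iso.comp_inv_eq, Category.assoc, f.comm, Iso.inv_hom_id_assoc]
  · ext
    change 𝟙 _ ≫ (P.α a).inv = ((η a : k) • (P.α a).inv) ≫
      ((η a⁻¹ : k) • ((A.dual.commIso χ⁻¹ η).hom.app P).f)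
    rw [dual_commIso_hom_app_f]
    refine (Category.id_comp _).trans (Eq.symm ((Linear.comp_smul _ _ _ _ _ _).trans ?_))
    refine (congrArg _ (Category.comp_id _)).trans ?_
    rw [map_inv, Units.val_inv_eq_inv_val]
    exact inv_smul_smul₀ (η a).ne_zero _

end LinearAction

/-! ### Induced equivariant objects -/

namespace LinearAction

section Unit

variable {G : Type x} [Group G] (A : LinearAction k G C)

/-- The canonical isomorphism `F_1 ≅ Id`, characterized by `F_1(u_X) = (ε_{1,1})_X`. -/
noncomputable def unitIso : A.F 1 ≅ 𝟭 C :=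
  NatIso.ofComponents (fun X => (A.F 1).preimageIso ((A.mulIso (mul_one (1 : G))).app X)) fun f =>
    (A.F 1).map_injective (by simpa using A.mulIso_naturality (mul_one (1 : G)) f)

lemma map_unitIso_hom_app (X : C) :
    (A.F 1).map (A.unitIso.hom.app X) = (A.mulIso (mul_one (1 : G))).hom.app X := by
  simp [unitIso]

variable {A} in
lemma α_one_comp_unitIso (P : EquivariantObject A) :
    (P.α 1).hom ≫ A.unitIso.hom.app P.X = 𝟙 P.X := by
  have h := P.α_mul (mul_one (1 : G))
  rw [← A.map_unitIso_hom_app, ← Functor.map_comp] at h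
  refine (A.F 1).map_injective ?_
  rw [← cancel_epi (P.α 1).hom, h, CategoryTheory.Functor.map_id, Category.comp_id]

end Unit

variable [HasFiniteBiproducts C] {G : Type x} [Group G] [Finite G] (A : LinearAction k G C)

/-- The underlying object `⨁_g F_g X` of the equivariant object induced by `X`. -/
noncomputable abbrev indObj (X : C) : C := ⨁ fun g => (A.F g).obj X

/-- The inverse of the structure map `⨁_g F_g X ≅ F_h (⨁_g F_g X)` of the induced object; it
identifies `F_h F_g X` with `F_{hg} X`. -/
noncomputable def indStructure (X : C) (h : G) :
    (A.F h).obj (A.indObj X) ≅ A.indObj X :=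
  (A.F h).mapBiproduct _ ≪≫
    biproduct.whiskerEquiv (Equiv.mulLeft h) fun g => ((A.ε h g).app X).symm

lemma map_ι_comp_indStructure_hom (X : C) {h g m : G} (e : h * g = m) :
    (A.F h).map (biproduct.ι (fun g => (A.F g).obj X) g) ≫ (A.indStructure X h).hom =
      (A.mulIso e).hom.app X ≫ biproduct.ι (fun g => (A.F g).obj X) m := by
  subst e
  rw [← ι_comp_mapBiproduct_inv, indStructure, Iso.trans_hom, Category.assoc,
    Iso.inv_hom_id_assoc, mulIso_rfl]
  exact biproduct.ι_desc _ _

lemma ε_comp_indStructure_hom (X : C) (g h : G) :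
    (A.ε g h).hom.app _ ≫ (A.indStructure X (g * h)).hom =
      (A.F g).map (A.indStructure X h).hom ≫ (A.indStructure X g).hom := by
  refine map_biproduct_hom_ext (A.F h ⋙ A.F g) fun l => ?_
  have e := (mul_assoc g h l).symm
  rw [← mulIso_rfl, Functor.comp_map, reassoc_of% A.mulIso_naturality rfl,
    A.map_ι_comp_indStructure_hom X rfl, ← Functor.map_comp_assoc,
    A.map_ι_comp_indStructure_hom X rfl, Functor.map_comp_assoc,
    A.map_ι_comp_indStructure_hom X e, ← reassoc_of% A.mulIso_assoc rfl rfl rfl e]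

/-- The equivariant object induced by `X`. -/
noncomputable abbrev ind (X : C) : EquivariantObject A where
  X := A.indObj X
  α h := (A.indStructure X h).symm
  rel g h := by
    rw [← cancel_mono (A.indStructure X (g * h)).hom, Category.assoc, Category.assoc,
      ε_comp_indStructure_hom]
    simp [← Functor.map_comp_assoc]

/-- The unit `X ⟶ ⨁_g F_g X` of induction, the inclusion of the summand `X ≅ F_1 X`. -/
noncomputable def toInd (X : C) : X ⟶ A.indObj X :=
  A.unitIso.inv.app X ≫ biproduct.ι (fun g => (A.F g).obj X) 1

/-- The projection of `⨁_g F_g X` to the summand `F_1 X ≅ X`. -/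
noncomputable def fromInd (X : C) : A.indObj X ⟶ X :=
  biproduct.π (fun g => (A.F g).obj X) 1 ≫ A.unitIso.hom.app X

lemma toInd_fromInd (X : C) : A.toInd X ≫ A.fromInd X = 𝟙 X := by
  simp [toInd, fromInd]

instance (X : C) : IsSplitMono (A.toInd X) :=
  ⟨⟨A.fromInd X, A.toInd_fromInd X⟩⟩

section Lift

variable {A} {X : C} (P : EquivariantObject A) (f : X ⟶ P.X)

/-- The morphism `⨁_g F_g X ⟶ P` whose restriction to the summand `F_g X` is `α_g⁻¹ ∘ F_g(f)`. -/
noncomputable def indDesc : A.indObj X ⟶ P.X :=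
  biproduct.desc fun g => (A.F g).map f ≫ (P.α g).inv

lemma indStructure_hom_comp_indDesc (h : G) :
    (A.indStructure X h).hom ≫ indDesc P f = (A.F h).map (indDesc P f) ≫ (P.α h).inv := by
  refine map_biproduct_hom_ext (A.F h) fun g => ?_
  rw [reassoc_of% A.map_ι_comp_indStructure_hom X rfl, ← Functor.map_comp_assoc, indDesc,
    biproduct.ι_desc, biproduct.ι_desc, ← reassoc_of% A.mulIso_naturality rfl,
    P.mulIso_comp_α_inv, Functor.map_comp_assoc]

lemma toInd_comp_indDesc : A.toInd X ≫ indDesc P f = f := by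
  have hf := A.unitIso.inv.naturality f
  have hP : (P.α 1).hom = A.unitIso.inv.app P.X := by
    rw [← cancel_mono (A.unitIso.hom.app P.X), α_one_comp_unitIso, Iso.inv_hom_id_app]
    rfl
  dsimp only [Functor.id_map] at hf
  rw [toInd, indDesc, Category.assoc, biproduct.ι_desc, ← reassoc_of% hf, ← hP,
    Iso.hom_inv_id, Category.comp_id]

/-- The morphism `Ind X ⟶ P` corresponding to `f : X ⟶ P` under the adjunction between induction
and the forgetful functor. -/
noncomputable def indLift : A.ind X ⟶ P :=
  EquivariantObject.homMkOfInv (indDesc P f) (indStructure_hom_comp_indDesc P f)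

end Lift

section Scale

variable (χ : G →* kˣ) (X : C)

/-- The endomorphism of `⨁_g F_g X` that scales the summand `F_g X` by `χ(g)`. -/
noncomputable def indScale : A.indObj X ⟶ A.indObj X :=
  biproduct.map fun g => (χ g : k) • 𝟙 ((A.F g).obj X)

lemma indStructure_hom_comp_indScale (h : G) :
    (A.indStructure X h).hom ≫ A.indScale χ X =
      (A.F h).map (A.indScale χ X) ≫ ((χ h : k) • (A.indStructure X h).hom) := by
  refine map_biproduct_hom_ext (A.F h) fun g => ?_
  rw [reassoc_of% A.map_ι_comp_indStructure_hom X rfl, ← Functor.map_comp_assoc, indScale,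
    biproduct.ι_map, biproduct.ι_map, Linear.smul_comp, Linear.smul_comp, Functor.map_smul,
    Category.id_comp, Category.id_comp, Linear.smul_comp, Linear.comp_smul, Linear.comp_smul,
    A.map_ι_comp_indStructure_hom X rfl, smul_smul, map_mul, Units.val_mul, mul_comm]

lemma toInd_comp_indScale : A.toInd X ≫ A.indScale χ X = A.toInd X := by
  simp [toInd, indScale]

/-- The scaling `A.indScale χ X`, as a morphism from `Ind X` to its twist by `χ`. -/
noncomputable def indTwist : A.ind X ⟶ (A.dualFunctor χ).obj (A.ind X) :=
  EquivariantObject.homMkOfInv (A.indScale χ X) (A.indStructure_hom_comp_indScale χ X)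

variable {A X}

/-- On a summand `F_g X` with `g ≠ 1` some `χ(g) ≠ 1` acts, so an invariant morphism has no
component there. -/
lemma comp_fromInd_comp_toInd (hsep : ∀ g : G, g ≠ 1 → ∃ χ : G →* kˣ, χ g ≠ 1) {W : C}
    (f : W ⟶ A.indObj X) (hf : ∀ χ : G →* kˣ, f ≫ A.indScale χ X = f) :
    f ≫ A.fromInd X ≫ A.toInd X = f := by
  refine biproduct.hom_ext _ _ fun g => ?_
  by_cases hg : g = 1
  · subst hg
    simp [toInd, fromInd]
  · obtain ⟨χ, hχ⟩ := hsep g hg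
    have h : (χ g : k) • (f ≫ biproduct.π _ g) = f ≫ biproduct.π _ g := by
      simpa [indScale] using congrArg (· ≫ biproduct.π _ g) (hf χ)
    have h_zero : f ≫ biproduct.π _ g = 0 := by
      rw [← sub_eq_zero, ← one_smul k (f ≫ _), smul_smul, mul_one, ← sub_smul] at h
      exact (smul_eq_zero.1 h).resolve_left (sub_ne_zero.2 (Units.val_eq_one.not.2 hχ))
    simp [toInd, h_zero, biproduct.ι_π_ne _ (Ne.symm hg)]

end Scale

end LinearAction

/-! ### Descent from equivariant objects -/

open LinearAction

namespace EquivariantAutoequivalence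

variable {G : Type x} [Group G] {A : LinearAction k G C} {E : EquivariantAutoequivalence A}
  (Φ : E.equivariantFunctor ⟶ 𝟭 (EquivariantObject A))

/-- The morphism of `C` underlying the component of `Φ` at `P`. -/
def underlying (P : EquivariantObject A) : E.F.obj P.X ⟶ P.X :=
  (Φ.app P).f

lemma underlying_naturality {P Q : EquivariantObject A} (f : P ⟶ Q) :
    E.F.map f.f ≫ underlying Φ Q = underlying Φ P ≫ f.f :=
  congrArg EquivariantObject.Hom.f (Φ.naturality f)

lemma map_α_inv_comp_underlying (P : EquivariantObject A) (g : G) :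
    E.F.map (P.α g).inv ≫ underlying Φ P =
      (E.δ g).hom.app P.X ≫ (A.F g).map (underlying Φ P) ≫ (P.α g).inv := by
  have h : underlying Φ P ≫ (P.α g).hom =
      (E.F.map (P.α g).hom ≫ (E.δ g).hom.app P.X) ≫ (A.F g).map (underlying Φ P) :=
    (Φ.app P).comm g
  rw [← cancel_epi (E.F.map (P.α g).hom), ← cancel_mono (P.α g).hom]
  simp only [Category.assoc, Iso.inv_hom_id, Category.comp_id]
  rw [← Functor.map_comp_assoc, Iso.hom_inv_id, CategoryTheory.Functor.map_id, Category.id_comp,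
    h, Category.assoc]

variable [HasFiniteBiproducts C] [Finite G]

/-- The component at `X` of the natural transformation `E.F ⟶ 𝟭 C` that `Φ` descends to: the
restriction of `Φ` at `Ind X` to the summand `X`. -/
noncomputable def descent (X : C) : E.F.obj X ⟶ X :=
  E.F.map (A.toInd X) ≫ underlying Φ (A.ind X) ≫ A.fromInd X

section Invariant

variable {Φ} (hsep : ∀ g : G, g ≠ 1 → ∃ χ : G →* kˣ, χ g ≠ 1)
  (hΦ : ∀ (χ : G →* kˣ) P, underlying Φ ((A.dualFunctor χ).obj P) = underlying Φ P)

include hsep hΦ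

lemma map_toInd_comp_underlying (X : C) :
    E.F.map (A.toInd X) ≫ underlying Φ (A.ind X) = descent Φ X ≫ A.toInd X := by
  have h_inv (χ : G →* kˣ) : (E.F.map (A.toInd X) ≫ underlying Φ (A.ind X)) ≫ A.indScale χ X =
      E.F.map (A.toInd X) ≫ underlying Φ (A.ind X) := by
    have h : E.F.map (A.indScale χ X) ≫ underlying Φ (A.ind X) =
        underlying Φ (A.ind X) ≫ A.indScale χ X := by
      rw [← hΦ χ]
      exact (underlying_naturality Φ (A.indTwist χ X)).trans (by rw [hΦ]; rfl)
    rw [Category.assoc, ← h, ← Functor.map_comp_assoc, A.toInd_comp_indScale]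
  have h := comp_fromInd_comp_toInd hsep _ h_inv
  rw [descent, Category.assoc, Category.assoc, ← Category.assoc, h]

lemma map_comp_underlying {X : C} (P : EquivariantObject A) (f : X ⟶ P.X) :
    E.F.map f ≫ underlying Φ P = descent Φ X ≫ f := by
  have h : E.F.map (indDesc P f) ≫ underlying Φ P =
      underlying Φ (A.ind X) ≫ indDesc P f :=
    underlying_naturality Φ (indLift P f)
  calc E.F.map f ≫ underlying Φ P
      = E.F.map (A.toInd X) ≫ E.F.map (indDesc P f) ≫ underlying Φ P := by
        rw [← Functor.map_comp_assoc, toInd_comp_indDesc]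
    _ = descent Φ X ≫ A.toInd X ≫ indDesc P f := by
        rw [h, reassoc_of% map_toInd_comp_underlying hsep hΦ X]
    _ = descent Φ X ≫ f := by rw [toInd_comp_indDesc]

lemma descent_naturality {X Y : C} (f : X ⟶ Y) :
    E.F.map f ≫ descent Φ Y = descent Φ X ≫ f := by
  rw [← cancel_mono (A.toInd Y), Category.assoc, Category.assoc,
    ← map_toInd_comp_underlying hsep hΦ, ← Functor.map_comp_assoc]
  exact map_comp_underlying hsep hΦ (A.ind Y) (f ≫ A.toInd Y)

lemma descent_eq_underlying (P : EquivariantObject A) : descent Φ P.X = underlying Φ P := by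
  simpa using (map_comp_underlying hsep hΦ P (𝟙 P.X)).symm

lemma δ_comp_map_descent (g : G) (X : C) :
    (E.δ g).hom.app X ≫ (A.F g).map (descent Φ X) = descent Φ ((A.F g).obj X) := by
  have hδ := (E.δ g).hom.naturality (A.toInd X)
  dsimp only [Functor.comp_map] at hδ
  rw [← cancel_mono ((A.F g).map (A.toInd X) ≫ ((A.ind X).α g).inv)]
  symm
  calc descent Φ ((A.F g).obj X) ≫ (A.F g).map (A.toInd X) ≫ ((A.ind X).α g).inv
      = E.F.map ((A.F g).map (A.toInd X)) ≫ E.F.map ((A.ind X).α g).inv ≫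
          underlying Φ (A.ind X) := by
        rw [← map_comp_underlying hsep hΦ, Functor.map_comp, Category.assoc]
    _ = (E.δ g).hom.app X ≫ (A.F g).map (E.F.map (A.toInd X) ≫ underlying Φ (A.ind X)) ≫
          ((A.ind X).α g).inv := by
        rw [map_α_inv_comp_underlying, reassoc_of% hδ, Functor.map_comp_assoc]
    _ = ((E.δ g).hom.app X ≫ (A.F g).map (descent Φ X)) ≫ (A.F g).map (A.toInd X) ≫
          ((A.ind X).α g).inv := by
        rw [map_toInd_comp_underlying hsep hΦ, Functor.map_comp_assoc, Category.assoc]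

lemma isIso_descent [IsIso Φ] (X : C) : IsIso (descent Φ X) := by
  let φ : E.F ⟶ 𝟭 C := { app := descent Φ, naturality _ _ := descent_naturality hsep hΦ }
  have h_ind : IsIso (φ.app (A.indObj X)) := by
    change IsIso (descent Φ (A.ind X).X)
    rw [descent_eq_underlying hsep hΦ]
    refine ⟨(inv (Φ.app (A.ind X))).f, ?_, ?_⟩
    · exact congrArg EquivariantObject.Hom.f (IsIso.hom_inv_id (Φ.app (A.ind X)))
    · exact congrArg EquivariantObject.Hom.f (IsIso.inv_hom_id (Φ.app (A.ind X)))
  exact MorphismProperty.of_retract (P := MorphismProperty.isomorphisms C)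
    (NatTrans.retractArrowApp φ ⟨A.toInd X, A.fromInd X, A.toInd_fromInd X⟩) h_ind

end Invariant

lemma isomorphic_one_of_equivariantization (hsep : ∀ g : G, g ≠ 1 → ∃ χ : G →* kˣ, χ g ≠ 1)
    (h : E.equivariantization.Isomorphic (one A.dual)) : E.Isomorphic (one A) := by
  obtain ⟨Φ : E.equivariantFunctor ≅ 𝟭 (EquivariantObject A), hΦ⟩ := h
  have hΦ' (χ : G →* kˣ) (P : EquivariantObject A) :
      underlying Φ.hom ((A.dualFunctor χ).obj P) = underlying Φ.hom P :=
    ((Category.id_comp _).symm.trans ((congrArg EquivariantObject.Hom.f (hΦ χ P)).trans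
      (Category.comp_id _))).symm
  have (X : C) : IsIso (descent Φ.hom X) := isIso_descent hsep hΦ' X
  let e (X : C) : E.F.obj X ≅ X := asIso (descent Φ.hom X)
  exact ⟨NatIso.ofComponents e (descent_naturality hsep hΦ'),
    fun g X => (δ_comp_map_descent hsep hΦ' g X).trans (Category.comp_id _).symm⟩

end EquivariantAutoequivalence

/-! ### The equivariantization homomorphism -/

lemma equivariantizationHom_injective {G : Type x} [Group G] [Finite G] [HasFiniteBiproducts C]
    (hsep : ∀ g : G, g ≠ 1 → ∃ χ : G →* kˣ, χ g ≠ 1) (A : LinearAction k G C) :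
    Function.Injective (equivariantizationHom A) := by
  refine (injective_iff_map_eq_one _).2 fun x hx => ?_
  obtain ⟨E, rfl⟩ := cls_surjective x
  exact cls_eq_cls.2 (E.isomorphic_one_of_equivariantization hsep (cls_eq_cls.1 hx))

section Act

variable {G : Type x} [CommGroup G]

lemma cls_translation_twist_mem_act (A : LinearAction k G C) (a : G) (χ : G →* kˣ) :
    cls ((A.translation a).twist χ) ∈ A.act :=
  ⟨_, rfl, a, ⟨Iso.refl _⟩⟩

lemma CenterEqScalars.exists_eq_cls_translation_twist (hC : CenterEqScalars k C)
    {A : LinearAction k G C} {x : A.AutGroup} (hx : x ∈ A.act) :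
    ∃ (a : G) (χ : G →* kˣ), x = cls ((A.translation a).twist χ) := by
  obtain ⟨E, rfl, a, ⟨φ⟩⟩ := hx
  obtain ⟨χ, hχ⟩ := E.exists_isomorphic_twist hC (A.translation a) φ
  exact ⟨a, χ, cls_eq_cls.2 hχ⟩

lemma equivariantizationHom_cls_translation_twist (A : LinearAction k G C) (a : G)
    (χ : G →* kˣ) :
    equivariantizationHom A (cls ((A.translation a).twist χ)) =
      cls ((A.dual.translation χ⁻¹).twist (MonoidHom.eval a⁻¹)) :=
  cls_eq_cls.2 (translation_twist_equivariantization a χ)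

lemma CenterEqScalars.equivariantizationHom_mem_act (hC : CenterEqScalars k C)
    {A : LinearAction k G C} {x : A.AutGroup} (hx : x ∈ A.act) :
    equivariantizationHom A x ∈ A.dual.act := by
  obtain ⟨a, χ, rfl⟩ := hC.exists_eq_cls_translation_twist hx
  rw [equivariantizationHom_cls_translation_twist]
  exact cls_translation_twist_mem_act _ _ _

lemma SplitsOver.exists_equivariantizationHom_eq [Finite G] (hG : SplitsOver k G)
    {A : LinearAction k G C} (hCG : CenterEqScalars k (EquivariantObject A))
    {y : A.dual.AutGroup} (hy : y ∈ A.dual.act) :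
    ∃ x ∈ A.act, equivariantizationHom A x = y := by
  obtain ⟨χ, l, rfl⟩ := hCG.exists_eq_cls_translation_twist hy
  obtain ⟨a, rfl⟩ := hG.eval_bijective.surjective l
  exact ⟨_, cls_translation_twist_mem_act A a⁻¹ χ⁻¹, by
    rw [equivariantizationHom_cls_translation_twist, inv_inv a, inv_inv χ]⟩

end Act

end Equivariantization

open Equivariantization in
theorem proposition5p6_general {k : Type*} [Field k] {G : Type*} [CommGroup G] [Finite G]
    (hG : SplitsOver k G)
    {C : Type*} [Category C] [Preadditive C] [Linear k C] [HasFiniteBiproducts C]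
    (A : LinearAction k G C)
    (hC : CenterEqScalars k C)
    (hCG : CenterEqScalars k (EquivariantObject A)) :
    ∃ e : A.act ≃* A.dual.act,
      ∀ x : A.act, (e x : A.dual.AutGroup) =
        equivariantizationHom A (x : A.AutGroup) := by
  let f : A.act →* A.dual.act :=
    ((equivariantizationHom A).comp A.act.subtype).codRestrict A.dual.act
      fun x => hC.equivariantizationHom_mem_act x.2
  have f_injective : Function.Injective f := fun x y hxy =>
    Subtype.ext (equivariantizationHom_injective (fun _ => hG.exists_character_apply_ne_one) A
      (congrArg Subtype.val hxy))
  have f_surjective : Function.Surjective f := by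
    rintro ⟨y, hy⟩
    obtain ⟨x, hx, rfl⟩ := hG.exists_equivariantizationHom_eq hCG hy
    exact ⟨⟨x, hx⟩, rfl⟩
  exact ⟨MulEquiv.ofBijective f ⟨f_injective, f_surjective⟩, fun _ => rfl⟩

theorem proposition5p6 {k : Type*} [Field k] {G : Type*} [CommGroup G] [Finite G]
    (hG : Equivariantization.SplitsOver k G)
    {C : Type*} [Category C] [Preadditive C] [Linear k C] [HasFiniteBiproducts C]
    [IsIdempotentComplete C]
    (A : Equivariantization.LinearAction k G C)
    (hC : Equivariantization.CenterEqScalars k C)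
    (hCG : Equivariantization.CenterEqScalars k (Equivariantization.EquivariantObject A)) :
    ∃ e : A.act ≃* A.dual.act,
      ∀ x : A.act, (e x : A.dual.AutGroup) =
        Equivariantization.equivariantizationHom A (x : A.AutGroup) :=
  proposition5p6_general hG A hC hCG
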